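/- \textbf{Setting.} A Dyck word is a well-formed word $\sigma=\sigma(1)\dots\sigma(N)$ over $\{+,-\}$ ($+$ opening, $-$ closing bracket). Positions $i<j$ are \emph{matched} in $\sigma$ if $\sigma(i)={+}$, $\sigma(j)={-}$ and $\sigma(i+1)\dots\sigma(j-1)$ is a Dyck word. Suppose $\sigma={+}\tau{-}$ with $\tau$ a Dyck word. The \emph{rooted tree $D$ associated with $\sigma$} has the matched pairs as its nodes, and the parent of a node is the innermost matched pair that strictly encloses it; $D$ is \emph{binary} if every node has at most two children. A \emph{re-pairing} of $\sigma$ is a sequence of pairs $(\ell_1,r_1),\dots,(\ell_{N/2},r_{N/2})$ with $\ell_i<r_i$, $\sigma(\ell_i)={+}$, $\sigma(r_i)={-}$, such that every position in $\{1,\dots,N\}$ occurs in exactly one pair; it is \emph{simple} if every $(\ell_i,r_i)$ is matched in $\sigma$. Its \emph{width} is the maximum over $0\le t\le N/2$ of the smallest number of integer intervals whose union is $\{\ell_1,r_1,\dots,\ell_t,r_t\}$. \textbf{Statement.} There is an absolute constant $C$ such that the following holds for every Dyck word $\sigma={+}\tau{-}$ ($\tau$ a Dyck word) whose associated tree $D$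 is binary. Let $w$ be the minimum width of a simple re-pairing of $\sigma$, and let $h$ be the maximum height (number of edges on a longest root-to-leaf path) of a complete binary tree that is a minor of $D$ as an undirected graph (both exist). Then $h\le C\,w$, and if $D$ has at least three nodes, then also $w\le C\,h$. -/

import Mathlib

/-! Conventions: the opening bracket `+` is `DyckStep.U`, the closing bracket `-` is `DyckStep.D`, a
well-formed word `σ` is a `DyckWord`, and its positions are numbered from `0`. -/

/-- The width of a set `S` of integers: the smallest number of intervals
`[a, b] = {x ∈ ℤ | a ≤ x ≤ b}` whose union is `S`. -/
noncomputable def intervalWidth (S : Set ℤ) : ℕ :=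
  sInf {k : ℕ | ∃ I : Fin k → ℤ × ℤ, S = ⋃ i, Set.Icc (I i).1 (I i).2}

namespace DyckWord

/-- Positions in the word `σ`. -/
abbrev Pos (σ : DyckWord) : Type := Fin σ.toList.length

/-- The plus at position `i` and the minus at position `j` are matched to each other in `σ`: the
factor of `σ` from `i` to `j` has the form `+ w -` where `w` is a well-formed word. -/
def Matched (σ : DyckWord) (i j : σ.Pos) : Prop :=
  i < j ∧ σ.toList.get i = DyckStep.U ∧ σ.toList.get j = DyckStep.D ∧
    ∃ w : DyckWord, w.toList = (σ.toList.take j).drop (i + 1)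

/-- A re-pairing of `σ`: a sequence of `|σ| / 2` pairs of positions, each consisting of a plus and
of a minus to its right, such that every position occurs in exactly one pair of the sequence. -/
structure Repairing (σ : DyckWord) where
  pair : Fin σ.semilength → σ.Pos × σ.Pos
  left_plus : ∀ t, σ.toList.get (pair t).1 = DyckStep.U
  right_minus : ∀ t, σ.toList.get (pair t).2 = DyckStep.D
  left_lt_right : ∀ t, (pair t).1 < (pair t).2
  existsUnique : ∀ k : σ.Pos, ∃! t, (pair t).1 = k ∨ (pair t).2 = k

namespace Repairing

variable {σ : DyckWord}

/-- The set of positions (as integers) erased by the first `t` moves. -/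
def erased (p : σ.Repairing) (t : ℕ) : Set ℤ :=
  {b : ℤ | ∃ i : Fin σ.semilength, (i : ℕ) < t ∧
    (b = ((p.pair i).1 : ℕ) ∨ b = ((p.pair i).2 : ℕ))}

/-- The width of a re-pairing: the maximum over all times of the width of the erased set. -/
noncomputable def width (p : σ.Repairing) : ℕ :=
  (Finset.range (σ.semilength + 1)).sup fun t => intervalWidth (p.erased t)

/-- A re-pairing is simple if it always pairs two signs that are matched in the word. -/
def IsSimple (p : σ.Repairing) : Prop :=
  ∀ t, σ.Matched (p.pair t).1 (p.pair t).2

end Repairing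

/-- The nodes of the rooted forest associated with `σ`: the pairs of matched signs. -/
def Node (σ : DyckWord) : Type := {p : σ.Pos × σ.Pos // σ.Matched p.1 p.2}

/-- The pair `u` lies strictly inside the pair `v`. -/
def Node.IsDescendant {σ : DyckWord} (u v : σ.Node) : Prop :=
  v.1.1 < u.1.1 ∧ u.1.2 < v.1.2

/-- `u` is a child of `v`: the pair `v` is the innermost pair around `u`. Thus for a matched factor
`+ w -` the children of its node are the top-level matched pairs of `w`. -/
def Node.IsChild {σ : DyckWord} (u v : σ.Node) : Prop :=
  u.IsDescendant v ∧ ¬ ∃ x : σ.Node, u.IsDescendant x ∧ x.IsDescendant v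

/-- The (undirected) graph underlying the rooted forest associated with `σ`. It is a tree exactly if
`σ` has the form `+ w -` with `w` well-formed, which is `σ.IsNested`. -/
def treeGraph (σ : DyckWord) : SimpleGraph σ.Node :=
  SimpleGraph.fromRel fun u v => u.IsChild v

/-- Every node of the forest associated with `σ` has at most two children. -/
def IsBinary (σ : DyckWord) : Prop :=
  ∀ v : σ.Node, {u : σ.Node | u.IsChild v}.ncard ≤ 2

end DyckWord

/-- `H` is a minor of `G`: there are pairwise disjoint (nonempty) connected branch sets in `G`, one
for each vertex of `H`, such that adjacent vertices of `H` have branch sets joined by an edge. -/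
def SimpleGraph.IsMinorOf {W V : Type*} (H : SimpleGraph W) (G : SimpleGraph V) : Prop :=
  ∃ B : W → Set V, (∀ w, (G.induce (B w)).Connected) ∧
    (∀ w w', w ≠ w' → Disjoint (B w) (B w')) ∧
    ∀ w w', H.Adj w w' → ∃ x ∈ B w, ∃ y ∈ B w', G.Adj x y

/-- The complete binary tree of height `h`, where height is counted in edges: the nodes are the
binary strings of length at most `h`, and the children of `s` are `false :: s` and `true :: s`. -/
def completeBinaryTree (h : ℕ) : SimpleGraph {s : List Bool // s.length ≤ h} :=
  SimpleGraph.fromRel fun s t => ∃ b : Bool, t.1 = b :: s.1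

/-!
If no node has more than two children, then every child of a node `v` owns a bracket next to one of
`v`, so adjacent nodes own adjacent positions and every edge between the erased and the remaining
nodes crosses the end of an interval of erased positions. Hence a simple re-pairing of width `w`
orders the nodes so that every initial segment is left by at most `2w` edges. On the other hand,
every ordering of a graph with a complete binary tree of height `h` as a minor has an initial
segment left by at least `⌊h/2⌋` edges: two levels down there are three disjoint subtrees, and the
cut which is large in the middle one, in the order in which these cuts occur, gains an edge outside
that subtree.

Conversely, erase the subtrees of the children of `v` recursively, the more demanding one first; a
completed subtree occupies a single interval. Only two equally demanding children force an
additional interval, and in that case the height of the complete binary tree minor rooted at `v`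
grows by one as well.
-/

/-! ### Unions of integer intervals -/

/-- `S` is a union of `n` integer intervals; some of them may be empty, so that the property is
monotone in `n`. -/
def IsUnionOfIntervals (n : ℕ) (S : Set ℤ) : Prop :=
  ∃ I : Fin n → ℤ × ℤ, S = ⋃ i, Set.Icc (I i).1 (I i).2

namespace IsUnionOfIntervals

variable {m n : ℕ} {S T : Set ℤ}

lemma intervalWidth_le (h : IsUnionOfIntervals n S) : intervalWidth S ≤ n :=
  Nat.sInf_le h

lemma empty (n : ℕ) : IsUnionOfIntervals n ∅ := ⟨fun _ => (1, 0), by simp⟩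

lemma eq_empty (h : IsUnionOfIntervals 0 S) : S = ∅ := by
  obtain ⟨I, rfl⟩ := h
  exact Set.iUnion_of_empty _

lemma icc (a b : ℤ) : IsUnionOfIntervals 1 (Set.Icc a b) :=
  ⟨fun _ => (a, b), (Set.iUnion_const _).symm⟩

lemma union (hS : IsUnionOfIntervals m S) (hT : IsUnionOfIntervals n T) :
    IsUnionOfIntervals (m + n) (S ∪ T) := by
  obtain ⟨I, rfl⟩ := hS
  obtain ⟨J, rfl⟩ := hT
  refine ⟨Fin.append I J, ?_⟩
  rw [← finSumFinEquiv.surjective.iUnion_comp, Set.iUnion_sum]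
  simp

lemma mono (hS : IsUnionOfIntervals m S) (hmn : m ≤ n) : IsUnionOfIntervals n S := by
  obtain ⟨k, rfl⟩ := Nat.exists_eq_add_of_le hmn
  simpa only [Set.union_empty] using hS.union (empty k)

lemma intervalWidth_of_finite (hS : S.Finite) : IsUnionOfIntervals (intervalWidth S) S := by
  refine Nat.sInf_mem (s := {k | IsUnionOfIntervals k S}) ?_
  induction S, hS using Set.Finite.induction_on with
  | empty => exact ⟨0, empty 0⟩
  | @insert a S _ _ ih =>
    obtain ⟨n, hn⟩ := ih
    have h : IsUnionOfIntervals (1 + n) (insert a S) := by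
      simpa only [Set.Icc_self, Set.singleton_union] using (icc a a).union hn
    exact ⟨1 + n, h⟩

end IsUnionOfIntervals

/-- The places where membership in `S` changes, each recorded by the integer to the left of it. -/
def switches (S : Set ℤ) : Set ℤ :=
  {i | ¬ (i ∈ S ↔ i + 1 ∈ S)}

lemma IsUnionOfIntervals.encard_switches_le {n : ℕ} {S : Set ℤ} (h : IsUnionOfIntervals n S) :
    (switches S).encard ≤ 2 * n := by
  obtain ⟨I, rfl⟩ := h
  have hsub : switches (⋃ i, Set.Icc (I i).1 (I i).2) ⊆
      (fun i => (I i).2) '' Set.univ ∪ (fun i => (I i).1 - 1) '' Set.univ := by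
    intro x hx
    simp only [switches, Set.mem_ofPred_eq, Set.mem_iUnion, Set.mem_Icc] at hx
    by_contra hne
    simp only [Set.image_univ, Set.mem_union, Set.mem_range, not_or, not_exists] at hne
    refine hx (exists_congr fun i => ?_)
    have := hne.1 i
    have := hne.2 i
    omega
  calc (switches (⋃ i, Set.Icc (I i).1 (I i).2)).encard
      ≤ (Set.univ : Set (Fin n)).encard + (Set.univ : Set (Fin n)).encard :=
        (Set.encard_le_encard hsub).trans ((Set.encard_union_le _ _).trans
          (add_le_add (Set.encard_image_le _ _) (Set.encard_image_le _ _)))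
    _ = 2 * n := by simp [two_mul]

/-! ### Cuts of branching sets -/

section Branching

variable {V α : Type*} [LinearOrder α] {G : SimpleGraph V}

/-- The edges of `G` from `A` to `B`, as ordered pairs. -/
def edgesBetween (G : SimpleGraph V) (A B : Set V) : Set (V × V) :=
  {e | e.1 ∈ A ∧ e.2 ∈ B ∧ G.Adj e.1 e.2}

lemma edgesBetween_mono {A A' B B' : Set V} (hA : A ⊆ A') (hB : B ⊆ B') :
    edgesBetween G A B ⊆ edgesBetween G A' B' :=
  fun _ he => ⟨hA he.1, hB he.2.1, he.2.2⟩

lemma edgesBetween_inter_sdiff_nonempty {A S : Set V} (hS : (G.induce S).Preconnected)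
    (hA : (S ∩ A).Nonempty) (hA' : (S \ A).Nonempty) :
    (edgesBetween G (S ∩ A) (S \ A)).Nonempty := by
  obtain ⟨a, haS, haA⟩ := hA
  obtain ⟨b, hbS, hbA⟩ := hA'
  obtain ⟨p⟩ := hS ⟨a, haS⟩ ⟨b, hbS⟩
  obtain ⟨d, -, hfst, hsnd⟩ := p.exists_boundary_dart (Subtype.val ⁻¹' A) haA hbA
  exact ⟨(d.fst, d.snd), ⟨d.fst.2, hfst⟩, ⟨d.snd.2, hsnd⟩, d.adj⟩

/-- `S` branches to depth `k`: it contains three disjoint sets branching to depth `k - 1`, none of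
which disconnects `S`. Subtrees of complete binary trees have this property, and it forces large
cuts. -/
def Branching (G : SimpleGraph V) : ℕ → Set V → Prop
  | 0, S => S.Nonempty
  | k + 1, S => ∃ T : Fin 3 → Set V, Pairwise (Function.onFun Disjoint T) ∧
      ∀ i, T i ⊆ S ∧ Branching G k (T i) ∧ (G.induce (S \ T i)).Preconnected

lemma exists_perm_strictMono_comp {n : ℕ} {g : Fin n → α} (hg : g.Injective) :
    ∃ e : Equiv.Perm (Fin n), StrictMono (g ∘ e) :=
  ⟨Tuple.sort g, (Tuple.monotone_sort g).strictMono_of_injective (hg.comp (Equiv.injective _))⟩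

-- Of the three initial segments provided by induction take the middle one: the other two parts
-- contribute vertices on both sides of it, hence an edge of the cut outside the middle part.
theorem Branching.exists_le_encard_edgesBetween {f : V → α} (hf : f.Injective) {k : ℕ} {S : Set V}
    (hS : Branching G k S) :
    ∃ v ∈ S, k ≤ (edgesBetween G (S ∩ f ⁻¹' Set.Iic (f v)) (S \ f ⁻¹' Set.Iic (f v))).encard := by
  induction k generalizing S with
  | zero =>
    obtain ⟨v, hv⟩ := hS
    exact ⟨v, hv, zero_le⟩
  | succ k ih =>
    obtain ⟨T, hdisj, hT⟩ := hS
    choose v hvT hvk using fun i => ih (hT i).2.1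
    have hinj : (f ∘ v).Injective := fun i j hij => by
      by_contra hne
      exact Set.disjoint_left.1 (hdisj hne) (hvT i) (hf hij ▸ hvT j)
    obtain ⟨e, he⟩ := exists_perm_strictMono_comp hinj
    set A := f ⁻¹' Set.Iic (f (v (e 1)))
    refine ⟨v (e 1), (hT _).1 (hvT _), ?_⟩
    have hmem : ∀ i, i ≠ 1 → v (e i) ∈ S \ T (e 1) := fun i hi =>
      ⟨(hT _).1 (hvT _), Set.disjoint_left.1 (hdisj (e.injective.ne hi)) (hvT _)⟩
    have hlow : v (e 0) ∈ A := (he (show (0 : Fin 3) < 1 by decide)).le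
    have hhigh : v (e 2) ∉ A := not_le.2 (he (show (1 : Fin 3) < 2 by decide))
    obtain ⟨q, hq⟩ := edgesBetween_inter_sdiff_nonempty (hT (e 1)).2.2
      ⟨_, hmem 0 (by decide), hlow⟩ ⟨_, hmem 2 (by decide), hhigh⟩
    have hqT : q ∉ edgesBetween G (T (e 1) ∩ A) (T (e 1) \ A) := fun h => hq.1.1.2 h.1.1
    calc ((k + 1 : ℕ) : ℕ∞) ≤ (edgesBetween G (T (e 1) ∩ A) (T (e 1) \ A)).encard + 1 := by
          push_cast
          exact add_le_add_left (hvk (e 1)) 1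
      _ = (insert q (edgesBetween G (T (e 1) ∩ A) (T (e 1) \ A))).encard :=
          (Set.encard_insert_of_notMem hqT).symm
      _ ≤ (edgesBetween G (S ∩ A) (S \ A)).encard := by
          refine Set.encard_le_encard (Set.insert_subset ?_ ?_)
          · exact edgesBetween_mono (Set.inter_subset_inter_left _ Set.sdiff_subset)
              (Set.sdiff_subset_sdiff_left Set.sdiff_subset) hq
          · exact edgesBetween_mono (Set.inter_subset_inter_left _ (hT _).1)
              (Set.sdiff_subset_sdiff_left (hT _).1)

end Branching

/-! ### Minor models of complete binary trees -/

section BinaryMinor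

variable {V : Type*} {G : SimpleGraph V} {k : ℕ}

/-- `B` is a family of branch sets exhibiting the complete binary tree of height `k` as a minor of
`G`. The branch sets are indexed by all binary strings, those of length more than `k` having an
empty branch set. -/
structure IsBinaryMinorModel (G : SimpleGraph V) (k : ℕ) (B : List Bool → Set V) : Prop where
  preconnected : ∀ s, (G.induce (B s)).Preconnected
  nonempty_iff : ∀ s, (B s).Nonempty ↔ s.length ≤ k
  disjoint : Pairwise (Function.onFun Disjoint B)
  exists_adj : ∀ s b, s.length < k → ∃ x ∈ B s, ∃ y ∈ B (b :: s), G.Adj x y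

lemma completeBinaryTree_adj {s t : {s : List Bool // s.length ≤ k}} :
    (completeBinaryTree k).Adj s t ↔ (∃ b, t.1 = b :: s.1) ∨ ∃ b, s.1 = b :: t.1 := by
  rw [completeBinaryTree, SimpleGraph.fromRel_adj, and_iff_right_iff_imp]
  rintro (⟨b, h⟩ | ⟨b, h⟩) rfl <;> simp at h

lemma completeBinaryTree_isMinorOf_iff :
    (completeBinaryTree k).IsMinorOf G ↔ ∃ B, IsBinaryMinorModel G k B := by
  constructor
  · rintro ⟨B, hconn, hdisj, hadj⟩
    refine ⟨fun s => ⋃ hs, B ⟨s, hs⟩, ?_, ?_, ?_, ?_⟩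
    · intro s
      by_cases hs : s.length ≤ k
      · rw [show ⋃ hs, B ⟨s, hs⟩ = B ⟨s, hs⟩ from iSup_pos hs]
        exact (hconn _).preconnected
      · rw [show ⋃ hs, B ⟨s, hs⟩ = ∅ from iSup_neg hs]
        exact .of_subsingleton
    · intro s
      rw [Set.nonempty_iUnion]
      exact ⟨fun h => h.1, fun hs => ⟨hs, Set.nonempty_coe_sort.1 (hconn ⟨s, hs⟩).nonempty⟩⟩
    · intro s t hst
      simp only [Function.onFun, Set.disjoint_iUnion_left, Set.disjoint_iUnion_right]
      exact fun _ _ => hdisj _ _ fun h => hst (congrArg Subtype.val h)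
    · intro s b hs
      obtain ⟨x, hx, y, hy, hxy⟩ := hadj ⟨s, hs.le⟩ ⟨b :: s, hs⟩
        (completeBinaryTree_adj.2 (.inl ⟨b, rfl⟩))
      exact ⟨x, Set.mem_iUnion_of_mem _ hx, y, Set.mem_iUnion_of_mem _ hy, hxy⟩
  · rintro ⟨B, hB⟩
    refine ⟨fun s => B s.1, fun s => ?_, fun s t hst => hB.disjoint (Subtype.coe_ne_coe.2 hst), ?_⟩
    · have := ((hB.nonempty_iff s.1).2 s.2).to_subtype
      exact ⟨hB.preconnected s.1⟩
    · rintro ⟨s, hs⟩ ⟨t, ht⟩ hst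
      obtain ⟨b, rfl⟩ | ⟨b, rfl⟩ := completeBinaryTree_adj.1 hst
      · exact hB.exists_adj s b ht
      · obtain ⟨x, hx, y, hy, hxy⟩ := hB.exists_adj t b hs
        exact ⟨y, hy, x, hx, hxy.symm⟩

/-- The union of the branch sets in the subtree with root `s`. -/
def below (B : List Bool → Set V) (s : List Bool) : Set V :=
  ⋃ (t) (_ : s <:+ t), B t

lemma below_subset_below {B : List Bool → Set V} {s t : List Bool} (hst : s <:+ t) :
    below B t ⊆ below B s :=
  Set.biUnion_mono (fun _ htu => hst.trans htu) fun _ _ => subset_rfl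

namespace IsBinaryMinorModel

variable {B : List Bool → Set V} {s t : List Bool} {x : V}

lemma eq_of_mem (hB : IsBinaryMinorModel G k B) (hs : x ∈ B s) (ht : x ∈ B t) : s = t :=
  hB.disjoint.eq (Set.not_disjoint_iff.2 ⟨x, hs, ht⟩)

lemma mem_below_iff (hB : IsBinaryMinorModel G k B) (ht : x ∈ B t) :
    x ∈ below B s ↔ s <:+ t := by
  simp only [below, Set.mem_iUnion, exists_prop]
  exact ⟨fun ⟨u, hsu, hu⟩ => hB.eq_of_mem hu ht ▸ hsu, fun h => ⟨t, h, ht⟩⟩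

lemma subset_below_sdiff_below (hB : IsBinaryMinorModel G k B) {r : List Bool}
    (hsr : s <:+ r) (htr : ¬ t <:+ r) : B r ⊆ below B s \ below B t :=
  fun _ hx => ⟨(hB.mem_below_iff hx).2 hsr, fun h => htr ((hB.mem_below_iff hx).1 h)⟩

lemma exists_connected_subset (hB : IsBinaryMinorModel G k B) {X : Set V} (r : List Bool)
    (hr : (r ++ s).length ≤ k) (hX : ∀ q, q <:+ r → B (q ++ s) ⊆ X) :
    ∃ P ⊆ X, B s ⊆ P ∧ B (r ++ s) ⊆ P ∧ (G.induce P).Preconnected := by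
  induction r with
  | nil => exact ⟨B s, hX [] List.suffix_rfl, subset_rfl, subset_rfl, hB.preconnected s⟩
  | cons b r ih =>
    obtain ⟨P, hPX, hsP, hrP, hP⟩ := ih (Nat.le_of_succ_le hr)
      fun q hq => hX q (hq.trans (List.suffix_cons b r))
    obtain ⟨x, hx, y, hy, hxy⟩ := hB.exists_adj (r ++ s) b hr
    exact ⟨P ∪ B (b :: r ++ s), Set.union_subset hPX (hX _ List.suffix_rfl),
      hsP.trans Set.subset_union_left, Set.subset_union_right,
      (SimpleGraph.connected_induce_union hP (hB.preconnected _) (hrP hx) hy hxy).preconnected⟩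

lemma preconnected_below_sdiff_below (hB : IsBinaryMinorModel G k B) (hs : s.length ≤ k)
    (hts : ¬ t <:+ s) : (G.induce (below B s \ below B t)).Preconnected := by
  obtain ⟨x, hx⟩ := (hB.nonempty_iff s).2 hs
  refine (SimpleGraph.induce_connected_of_patches x
    (hB.subset_below_sdiff_below List.suffix_rfl hts hx) fun {y} hy => ?_).preconnected
  obtain ⟨⟨_, ⟨u, rfl⟩, _, ⟨⟨r, rfl⟩, rfl⟩, hyr⟩, hyt⟩ := hy
  obtain ⟨P, hPX, hsP, hrP, hP⟩ := hB.exists_connected_subset r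
    ((hB.nonempty_iff _).1 ⟨y, hyr⟩) fun q hq =>
      hB.subset_below_sdiff_below (List.suffix_append q s) fun htq =>
        hyt ((hB.mem_below_iff hyr).2 (htq.trans (List.suffix_append_self_iff.2 hq)))
  exact ⟨P, hPX, hsP hx, hrP hyr, hP _ _⟩

lemma disjoint_below (hB : IsBinaryMinorModel G k B) (hlen : s.length = t.length) (hst : s ≠ t) :
    Disjoint (below B s) (below B t) := by
  rw [Set.disjoint_left]
  rintro x ⟨_, ⟨u, rfl⟩, _, ⟨hsu, rfl⟩, hx⟩ hxt
  have hsuf := List.suffix_of_suffix_length_le hsu ((hB.mem_below_iff hx).1 hxt) hlen.le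
  exact hst (hsuf.eq_of_length hlen)

lemma branching_below (hB : IsBinaryMinorModel G k B) {m : ℕ} (hs : s.length + 2 * m ≤ k) :
    Branching G m (below B s) := by
  induction m generalizing s with
  | zero =>
    obtain ⟨x, hx⟩ := (hB.nonempty_iff s).2 hs
    exact ⟨x, (hB.mem_below_iff hx).2 List.suffix_rfl⟩
  | succ m ih =>
    let g : Fin 3 → List Bool := ![[false, false], [true, false], [false, true]]
    have hlen : ∀ i, (g i).length = 2 := by decide
    have hinj : g.Injective := by decide
    refine ⟨fun i => below B (g i ++ s), fun i j hij => ?_, fun i => ⟨?_, ih ?_, ?_⟩⟩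
    · exact hB.disjoint_below (by simp only [List.length_append, hlen])
        fun h => hij (hinj (List.append_cancel_right h))
    · exact below_subset_below (List.suffix_append _ _)
    · rw [List.length_append, hlen]
      omega
    · refine hB.preconnected_below_sdiff_below (by omega) fun h => ?_
      have := h.length_le
      rw [List.length_append, hlen] at this
      omega

end IsBinaryMinorModel

lemma preconnected_induce_insert {S : Set V} {a v : V} (hS : (G.induce S).Preconnected)
    (ha : a ∈ S) (hva : G.Adj v a) : (G.induce (insert v S)).Preconnected := by
  have hv : (G.induce {v}).Preconnected := .of_subsingleton
  exact (SimpleGraph.connected_induce_union hv hS (Set.mem_singleton v) ha hva).preconnected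

/-- `G` has a complete binary tree of height `k` as a minor inside `S`, the branch set of the root
containing `v`. Keeping track of `v` allows minors to be composed at their roots. -/
def HasRootedBinaryMinor (G : SimpleGraph V) (k : ℕ) (S : Set V) (v : V) : Prop :=
  ∃ B, IsBinaryMinorModel G k B ∧ (∀ s, B s ⊆ S) ∧ v ∈ B []

namespace HasRootedBinaryMinor

variable {S T : Set V} {a v : V}

lemma isMinorOf (h : HasRootedBinaryMinor G k S v) : (completeBinaryTree k).IsMinorOf G :=
  completeBinaryTree_isMinorOf_iff.2 (h.imp fun _ hB => hB.1)

lemma mono (h : HasRootedBinaryMinor G k S v) (hST : S ⊆ T) : HasRootedBinaryMinor G k T v := by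
  obtain ⟨B, hB, hBS, hv⟩ := h
  exact ⟨B, hB, fun s => (hBS s).trans hST, hv⟩

lemma zero (G : SimpleGraph V) (v : V) : HasRootedBinaryMinor G 0 {v} v := by
  refine ⟨fun s => {x | s = [] ∧ x = v}, ⟨?_, ?_, ?_, ?_⟩, fun s x hx => hx.2, rfl, rfl⟩
  · rintro s ⟨x, hx⟩ ⟨y, hy⟩
    obtain rfl : x = y := hx.2.trans hy.2.symm
    rfl
  · exact fun s => by simp [Set.Nonempty]
  · exact fun s t hst => Set.disjoint_left.2 fun x hs ht => hst (hs.1.trans ht.1.symm)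
  · exact fun s b hs => absurd hs (Nat.not_lt_zero _)

lemma extend (h : HasRootedBinaryMinor G k S a) (hva : G.Adj v a) (hv : v ∉ S) :
    HasRootedBinaryMinor G k (insert v S) v := by
  obtain ⟨B, hB, hBS, ha⟩ := h
  have hvB : ∀ s, v ∉ B s := fun s hs => hv (hBS s hs)
  have hmem : ∀ s x, x ∈ Function.update B [] (insert v (B [])) s ↔ (s = [] ∧ x = v) ∨ x ∈ B s := by
    intro s x
    rcases eq_or_ne s [] with rfl | hs <;> simp [*]
  refine ⟨Function.update B [] (insert v (B [])), ⟨fun s => ?_, fun s => ?_, ?_, ?_⟩, ?_, ?_⟩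
  · rcases eq_or_ne s [] with rfl | hs
    · rw [Function.update_self]
      exact preconnected_induce_insert (hB.preconnected []) ha hva
    · rw [Function.update_of_ne hs]
      exact hB.preconnected s
  · rcases eq_or_ne s [] with rfl | hs
    · simp
    · rw [Function.update_of_ne hs, hB.nonempty_iff]
  · intro s t hst
    simp only [Function.onFun, Set.disjoint_left, hmem]
    rintro x (⟨rfl, rfl⟩ | hs) (⟨rfl, hx⟩ | ht)
    · exact hst rfl
    · exact hvB t ht
    · exact hvB s (hx ▸ hs)
    · exact hst (hB.eq_of_mem hs ht)
  · intro s b hs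
    obtain ⟨x, hx, y, hy, hxy⟩ := hB.exists_adj s b hs
    have hle : B ≤ Function.update B [] (insert v (B [])) :=
      le_update_self_iff.2 (Set.subset_insert _ _)
    exact ⟨x, hle _ hx, y, hle _ hy, hxy⟩
  · intro s x hx
    exact ((hmem s x).1 hx).imp (fun h => h.2) fun h => hBS s h
  · exact (hmem [] v).2 (.inl ⟨rfl, rfl⟩)

/-- The branch sets of a tree with root `v` and subtrees `A false` and `A true`. The subtree
containing a vertex is the last letter of its string, since strings grow at the front. -/
def joinBranchSets (v : V) (A : Bool → List Bool → Set V) (s : List Bool) : Set V :=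
  match s.reverse with
  | [] => {v}
  | b :: r => A b r.reverse

@[simp]
lemma joinBranchSets_append_singleton (v : V) (A : Bool → List Bool → Set V) (s : List Bool)
    (b : Bool) : joinBranchSets v A (s ++ [b]) = A b s := by
  simp [joinBranchSets]

@[simp]
lemma joinBranchSets_nil (v : V) (A : Bool → List Bool → Set V) : joinBranchSets v A [] = {v} :=
  rfl

lemma join {S : Bool → Set V} {a : Bool → V} (h : ∀ b, HasRootedBinaryMinor G k (S b) (a b))
    (hS : Pairwise (Function.onFun Disjoint S)) (hva : ∀ b, G.Adj v (a b)) (hv : ∀ b, v ∉ S b) :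
    HasRootedBinaryMinor G (k + 1) (insert v (⋃ b, S b)) v := by
  choose A hA hAS ha using h
  have hvA : ∀ b s, v ∉ A b s := fun b s hs => hv b (hAS b s hs)
  have ha' : ∀ b, a b ∈ joinBranchSets v A [b] := ha
  refine ⟨joinBranchSets v A, ⟨?_, ?_, ?_, ?_⟩, ?_, rfl⟩
  · intro s
    obtain rfl | ⟨s, b, rfl⟩ := s.eq_nil_or_concat'
    · exact .of_subsingleton (V := ({v} : Set V))
    · rw [joinBranchSets_append_singleton]
      exact (hA b).preconnected s
  · intro s
    obtain rfl | ⟨s, b, rfl⟩ := s.eq_nil_or_concat'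
    · simp
    · simp [joinBranchSets_append_singleton, (hA b).nonempty_iff]
  · intro s t hst
    obtain rfl | ⟨s, b, rfl⟩ := s.eq_nil_or_concat' <;>
      obtain rfl | ⟨t, c, rfl⟩ := t.eq_nil_or_concat' <;>
      simp only [Function.onFun, joinBranchSets_nil, joinBranchSets_append_singleton,
        Set.disjoint_singleton_left, Set.disjoint_singleton_right]
    · exact (hst rfl).elim
    · exact hvA c t
    · exact hvA b s
    · obtain rfl | hbc := eq_or_ne b c
      · exact (hA b).disjoint fun h => hst (h ▸ rfl)
      · exact (hS hbc).mono (hAS b s) (hAS c t)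
  · intro s c hs
    obtain rfl | ⟨s, b, rfl⟩ := s.eq_nil_or_concat'
    · exact ⟨v, rfl, a c, ha' c, hva c⟩
    · rw [← List.cons_append, joinBranchSets_append_singleton, joinBranchSets_append_singleton]
      exact (hA b).exists_adj s c (by simpa using hs)
  · intro s
    obtain rfl | ⟨s, b, rfl⟩ := s.eq_nil_or_concat'
    · simp
    · rw [joinBranchSets_append_singleton]
      exact (hAS b s).trans ((Set.subset_iUnion S b).trans (Set.subset_insert _ _))

lemma one {b : V} (hab : a ≠ b) (hva : G.Adj v a) (hvb : G.Adj v b) :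
    HasRootedBinaryMinor G 1 Set.univ v :=
  (join (S := fun c => {cond c a b}) (a := fun c => cond c a b) (fun _ => zero G _)
    (by rintro (_ | _) (_ | _) h <;> simp_all [Function.onFun, hab.symm])
    (Bool.forall_bool.2 ⟨hvb, hva⟩) (Bool.forall_bool.2 ⟨hvb.ne, hva.ne⟩)).mono (Set.subset_univ _)

end HasRootedBinaryMinor

end BinaryMinor

/-! ### Matched pairs as excursions of the height function -/

namespace DyckTree

open DyckStep

/-- The number of opening brackets minus the number of closing brackets. -/
def excess (l : List DyckStep) : ℤ :=
  l.count U - l.count D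

@[simp]
lemma excess_append (l m : List DyckStep) : excess (l ++ m) = excess l + excess m := by
  simp only [excess, List.count_append, Nat.cast_add]
  ring

lemma exists_toList_eq_iff {l : List DyckStep} :
    (∃ w : DyckWord, w.toList = l) ↔ excess l = 0 ∧ ∀ k, 0 ≤ excess (l.take k) := by
  simp only [excess, sub_eq_zero, sub_nonneg, Nat.cast_inj, Nat.cast_le]
  exact ⟨by rintro ⟨w, rfl⟩; exact ⟨w.count_U_eq_count_D, w.count_D_le_count_U⟩,
    fun h => ⟨⟨l, h.1, h.2⟩, rfl⟩⟩

/-- The number of brackets which are open after the first `k` letters of `σ`. -/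
def height (σ : DyckWord) (k : ℕ) : ℤ :=
  excess (σ.toList.take k)

variable {σ : DyckWord}

lemma height_zero (σ : DyckWord) : height σ 0 = 0 := rfl

lemma height_length (σ : DyckWord) : height σ σ.toList.length = 0 := by
  rw [height, List.take_length]
  exact (exists_toList_eq_iff.1 ⟨σ, rfl⟩).1

lemma height_nonneg (σ : DyckWord) (k : ℕ) : 0 ≤ height σ k :=
  (exists_toList_eq_iff.1 ⟨σ, rfl⟩).2 k

lemma height_succ (i : σ.Pos) :
    height σ (i + 1) = height σ i + excess [σ.toList.get i] := by
  rw [height, List.take_succ_eq_append_getElem i.2, excess_append]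
  rfl

lemma height_succ_of_eq_U {i : σ.Pos} (h : σ.toList.get i = U) :
    height σ (i + 1) = height σ i + 1 := by
  rw [height_succ, h]
  rfl

lemma height_succ_of_eq_D {i : σ.Pos} (h : σ.toList.get i = D) :
    height σ (i + 1) = height σ i - 1 := by
  rw [height_succ, h]
  rfl

lemma excess_drop_take {i j : ℕ} (hij : i ≤ j) :
    excess ((σ.toList.take j).drop i) = height σ j - height σ i := by
  have h := excess_append ((σ.toList.take j).take i) ((σ.toList.take j).drop i)
  rw [List.take_append_drop, List.take_take, min_eq_left hij] at h
  exact eq_sub_of_add_eq' h.symm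

lemma exists_toList_eq_drop_take_iff {i j : ℕ} (hij : i ≤ j) :
    (∃ w : DyckWord, w.toList = (σ.toList.take j).drop i) ↔
      height σ j = height σ i ∧ ∀ k, i ≤ k → k ≤ j → height σ i ≤ height σ k := by
  have htake : ∀ m, excess (((σ.toList.take j).drop i).take m) =
      height σ (min (i + m) j) - height σ i := fun m => by
    rw [List.take_drop, List.take_take, excess_drop_take (by omega)]
  simp only [exists_toList_eq_iff, excess_drop_take hij, htake, sub_eq_zero, sub_nonneg]
  refine and_congr_right fun _ => ⟨fun h k hik hkj => ?_, fun h m => h _ (by omega) (by omega)⟩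
  simpa only [Nat.add_sub_cancel' hik, min_eq_left hkj] using h (k - i)

lemma matched_iff {i j : σ.Pos} :
    σ.Matched i j ↔ i < j ∧ height σ (j + 1) = height σ i ∧
      ∀ k, (i : ℕ) < k → k ≤ (j : ℕ) → height σ i < height σ k := by
  refine and_congr_right fun hij => ?_
  have hij' : (i : ℕ) + 1 ≤ j := hij
  rw [exists_toList_eq_drop_take_iff hij']
  constructor
  · rintro ⟨hU, hD, hend, hpos⟩
    rw [height_succ_of_eq_U hU] at hend hpos
    exact ⟨by rw [height_succ_of_eq_D hD]; omega,
      fun k hik hkj => Int.lt_of_add_one_le (hpos k hik hkj)⟩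
  · rintro ⟨hend, hpos⟩
    have hU : σ.toList.get i = U := by
      refine (dichotomy _).resolve_right fun hD => ?_
      have := hpos _ (Nat.lt_succ_self _) hij'
      rw [height_succ_of_eq_D hD] at this
      omega
    have hD : σ.toList.get j = D := by
      refine (dichotomy _).resolve_left fun hU' => ?_
      have := hpos j hij le_rfl
      rw [height_succ_of_eq_U hU'] at hend
      omega
    rw [height_succ_of_eq_D hD] at hend
    rw [height_succ_of_eq_U hU]
    exact ⟨hU, hD, by omega, fun k hik hkj => hpos k hik hkj⟩

/-! ### The forest of matched pairs -/

/-- The position of the opening bracket of a node. -/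
abbrev left (u : σ.Node) : ℕ := u.1.1

/-- The position of the closing bracket of a node. -/
abbrev right (u : σ.Node) : ℕ := u.1.2

lemma left_lt_right (u : σ.Node) : left u < right u := u.2.1

lemma get_left (u : σ.Node) : σ.toList.get u.1.1 = U := u.2.2.1

lemma get_right (u : σ.Node) : σ.toList.get u.1.2 = D := u.2.2.2.1

lemma left_ne_right (u v : σ.Node) : left u ≠ right v := fun h => by
  have hU := get_left u
  rw [Fin.ext h, get_right v] at hU
  cases hU

lemma height_right_add_one (u : σ.Node) : height σ (right u + 1) = height σ (left u) :=
  (matched_iff.1 u.2).2.1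

lemma height_left_lt (u : σ.Node) {k : ℕ} (hl : left u < k) (hr : k ≤ right u) :
    height σ (left u) < height σ k :=
  (matched_iff.1 u.2).2.2 k hl hr

lemma right_lt_of_left_lt {u v : σ.Node} (h : left u < left v) (hv : left v ≤ right u) :
    right v < right u := by
  have hlt := height_left_lt u h hv
  have hru := height_right_add_one u
  by_contra! hle
  rcases hle.eq_or_lt with heq | hlt'
  · have hrv := height_right_add_one v
    rw [← heq] at hrv
    omega
  · have := height_left_lt v (k := right u + 1) (by omega) hlt'
    omega

lemma left_injective : Function.Injective (left (σ := σ)) := by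
  have hle : ∀ u v : σ.Node, left u = left v → right u ≤ right v := fun u v h => by
    by_contra! hlt
    have := height_left_lt u (k := right v + 1) (by have := left_lt_right v; omega) hlt
    rw [height_right_add_one, h] at this
    exact this.false
  intro u v h
  have hr := (hle u v h).antisymm (hle v u h.symm)
  exact Subtype.ext (Prod.ext (Fin.ext h) (Fin.ext hr))

lemma right_injective : Function.Injective (right (σ := σ)) := by
  intro u v h
  have hu := left_lt_right u
  have hv := left_lt_right v
  rcases lt_trichotomy (left u) (left v) with hlt | heq | hlt
  · have := right_lt_of_left_lt hlt (by omega)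
    omega
  · exact left_injective heq
  · have := right_lt_of_left_lt hlt (by omega)
    omega

lemma exists_left_eq {i : σ.Pos} (hi : σ.toList.get i = U) : ∃ u : σ.Node, u.1.1 = i := by
  classical
  have hex : ∃ k, (i : ℕ) < k ∧ height σ k ≤ height σ i :=
    ⟨σ.toList.length, i.2, (height_length σ).trans_le (height_nonneg σ i)⟩
  have hlength : Nat.find hex ≤ σ.toList.length :=
    Nat.find_min' hex ⟨i.2, (height_length σ).trans_le (height_nonneg σ i)⟩
  have hmin : ∀ k, (i : ℕ) < k → k < Nat.find hex → height σ i < height σ k :=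
    fun k hik hk => not_le.1 fun h => Nat.find_min hex hk ⟨hik, h⟩
  obtain ⟨hik, hle⟩ := Nat.find_spec hex
  obtain ⟨j, hj⟩ := Nat.exists_eq_add_one_of_ne_zero (Nat.ne_zero_of_lt hik)
  rw [hj] at hik hle hmin hlength
  have hij : (i : ℕ) < j := by
    refine (Nat.lt_succ_iff.1 hik).lt_of_ne fun h => ?_
    rw [← h, height_succ_of_eq_U hi] at hle
    omega
  have hreturn : height σ (j + 1) = height σ i := by
    have hlt := hmin j hij (Nat.lt_succ_self j)
    rcases dichotomy (σ.toList.get ⟨j, hlength⟩) with h | h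
    · have := height_succ_of_eq_U h
      dsimp only at this
      omega
    · have := height_succ_of_eq_D h
      dsimp only at this
      omega
  exact ⟨⟨(i, ⟨j, hlength⟩), matched_iff.2
    ⟨hij, hreturn, fun k hik hkj => hmin k hik (Nat.lt_succ_iff.2 hkj)⟩⟩, rfl⟩

instance : Finite σ.Node := Subtype.finite

lemma card_get_eq {α : Type*} [DecidableEq α] (l : List α) (a : α) :
    Nat.card {i : Fin l.length // l.get i = a} = l.count a := by
  rw [Nat.card_eq_fintype_card, Fintype.card_subtype]
  exact Fin.card_filter_univ_eq_vector_get_eq_count a ⟨l, rfl⟩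

lemma card_node (σ : DyckWord) : Nat.card σ.Node = σ.semilength := by
  rw [DyckWord.semilength, ← card_get_eq]
  refine Nat.card_eq_of_bijective (fun u => ⟨u.1.1, get_left u⟩) ⟨fun u v h => ?_, fun i => ?_⟩
  · exact left_injective (congrArg (fun i => (i.1 : ℕ)) h)
  · obtain ⟨u, hu⟩ := exists_left_eq i.2
    exact ⟨u, Subtype.ext hu⟩

lemma exists_right_eq {j : σ.Pos} (hj : σ.toList.get j = D) : ∃ u : σ.Node, u.1.2 = j := by
  have hinj : Function.Injective
      fun u : σ.Node => (⟨u.1.2, get_right u⟩ : {j : σ.Pos // σ.toList.get j = D}) :=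
    fun u v h => right_injective (congrArg (fun j => (j.1 : ℕ)) h)
  have hcard : Nat.card {j : σ.Pos // σ.toList.get j = D} ≤ Nat.card σ.Node := by
    rw [card_get_eq, card_node, DyckWord.semilength, σ.count_U_eq_count_D]
  obtain ⟨u, hu⟩ := (hinj.bijective_of_nat_card_le hcard).2 ⟨j, hj⟩
  exact ⟨u, congrArg Subtype.val hu⟩

/-- The position `k` is one of the two positions of the pair `u`. -/
def Owns (u : σ.Node) (k : ℕ) : Prop :=
  left u = k ∨ right u = k

lemma Owns.eq {u v : σ.Node} {k : ℕ} (hu : Owns u k) (hv : Owns v k) : u = v := by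
  rcases hu with rfl | rfl <;> rcases hv with h | h
  · exact (left_injective h).symm
  · exact (left_ne_right _ _ h.symm).elim
  · exact (left_ne_right _ _ h).elim
  · exact (right_injective h).symm

lemma exists_owns {k : ℕ} (hk : k < σ.toList.length) : ∃ u : σ.Node, Owns u k := by
  rcases dichotomy (σ.toList.get ⟨k, hk⟩) with h | h
  · exact (exists_left_eq h).imp fun u hu => .inl (congrArg Fin.val hu)
  · exact (exists_right_eq h).imp fun u hu => .inr (congrArg Fin.val hu)

lemma isDescendant_iff {u v : σ.Node} :
    u.IsDescendant v ↔ left v < left u ∧ right u < right v := Iff.rfl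

/-- The nodes `u` enclosed by `v`, including `v` itself. -/
def subtree (v : σ.Node) : Set σ.Node :=
  {u | left v ≤ left u ∧ right u ≤ right v}

lemma mem_subtree_self (v : σ.Node) : v ∈ subtree v := ⟨le_rfl, le_rfl⟩

lemma mem_subtree_iff {u v : σ.Node} : u ∈ subtree v ↔ u = v ∨ u.IsDescendant v := by
  constructor
  · rintro ⟨hl, hr⟩
    refine or_iff_not_imp_left.2 fun hne => ⟨hl.lt_of_ne ?_, hr.lt_of_ne ?_⟩
    · exact fun h => hne (left_injective h.symm)
    · exact fun h => hne (right_injective h)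
  · rintro (rfl | h)
    · exact mem_subtree_self _
    · exact ⟨h.1.le, h.2.le⟩

lemma trichotomy (u v : σ.Node) :
    u ∈ subtree v ∨ v ∈ subtree u ∨ right u < left v ∨ right v < left u := by
  rcases lt_trichotomy (left u) (left v) with h | h | h
  · rcases le_or_gt (left v) (right u) with h' | h'
    · exact .inr (.inl ⟨h.le, (right_lt_of_left_lt h h').le⟩)
    · exact .inr (.inr (.inl h'))
  · exact .inl (left_injective h ▸ mem_subtree_self _)
  · rcases le_or_gt (left u) (right v) with h' | h'
    · exact .inl ⟨h.le, (right_lt_of_left_lt h h').le⟩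
    · exact .inr (.inr (.inr h'))

lemma mem_subtree_of_owns {u v : σ.Node} {k : ℕ} (hu : Owns u k) (hl : left v ≤ k)
    (hr : k ≤ right v) : u ∈ subtree v := by
  have := left_lt_right u
  have := left_lt_right v
  rcases trichotomy u v with h | ⟨hl', hr'⟩ | h | h
  · exact h
  · rcases hu with rfl | rfl
    · rw [left_injective (hl'.antisymm hl)]
      exact mem_subtree_self _
    · rw [right_injective (hr.antisymm hr')]
      exact mem_subtree_self _
  · rcases hu with rfl | rfl <;> omega
  · rcases hu with rfl | rfl <;> omega

lemma exists_isChild_of_isDescendant {u v : σ.Node} (h : u.IsDescendant v) :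
    ∃ c : σ.Node, c.IsChild v ∧ u ∈ subtree c := by
  obtain ⟨c, ⟨hcv, huc⟩, hmin⟩ := Set.exists_min_image
    {c : σ.Node | c.IsDescendant v ∧ u ∈ subtree c} left (Set.toFinite _)
    ⟨u, h, mem_subtree_self u⟩
  refine ⟨c, ⟨hcv, ?_⟩, huc⟩
  rintro ⟨x, hcx, hxv⟩
  have hux : u ∈ subtree x := ⟨hcx.1.le.trans huc.1, huc.2.trans hcx.2.le⟩
  exact (hmin x ⟨hxv, hux⟩).not_gt hcx.1

lemma exists_isChild_parent {u v : σ.Node} (h : u.IsDescendant v) :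
    ∃ p : σ.Node, u.IsChild p := by
  obtain ⟨p, hp, hmax⟩ := Set.exists_max_image {p : σ.Node | u.IsDescendant p} left
    (Set.toFinite _) ⟨v, h⟩
  exact ⟨p, hp, fun ⟨x, hux, hxp⟩ => (hmax x hux).not_gt hxp.1⟩

lemma right_lt_left_or_of_isChild {a b v : σ.Node} (ha : a.IsChild v) (hb : b.IsChild v)
    (hab : a ≠ b) : right a < left b ∨ right b < left a := by
  rcases trichotomy a b with h | h | h
  · exact (ha.2 ⟨b, (mem_subtree_iff.1 h).resolve_left hab, hb.1⟩).elim
  · exact (hb.2 ⟨a, (mem_subtree_iff.1 h).resolve_left hab.symm, ha.1⟩).elim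
  · exact h

lemma disjoint_subtree {a b v : σ.Node} (ha : a.IsChild v) (hb : b.IsChild v) (hab : a ≠ b) :
    Disjoint (subtree a) (subtree b) := by
  refine Set.disjoint_left.2 fun u hua hub => ?_
  have hu := left_lt_right u
  have := hua.1.trans_lt (hu.trans_le hub.2)
  have := hub.1.trans_lt (hu.trans_le hua.2)
  have := right_lt_left_or_of_isChild ha hb hab
  omega

lemma subtree_eq_insert (v : σ.Node) :
    subtree v = insert v (⋃ c ∈ {c : σ.Node | c.IsChild v}, subtree c) := by
  ext u
  rw [mem_subtree_iff, Set.mem_insert_iff]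
  refine or_congr_right ⟨fun h => ?_, fun h => ?_⟩
  · obtain ⟨c, hc, huc⟩ := exists_isChild_of_isDescendant h
    exact Set.mem_biUnion hc huc
  · obtain ⟨c, hc, huc⟩ := Set.mem_iUnion₂.1 h
    exact ⟨hc.1.1.trans_le huc.1, huc.2.trans_lt hc.1.2⟩

lemma notMem_subtree_of_isChild {c v : σ.Node} (h : c.IsChild v) : v ∉ subtree c :=
  fun hv => hv.1.not_gt h.1.1

lemma exists_isChild_of_lt_of_lt {v : σ.Node} {k : ℕ} (hl : left v < k) (hr : k < right v) :
    ∃ c : σ.Node, c.IsChild v ∧ left c ≤ k ∧ k ≤ right c := by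
  obtain ⟨u, hu⟩ := exists_owns (hr.trans v.1.2.2)
  have hne : u ≠ v := by
    rintro rfl
    rcases hu with rfl | rfl
    · exact hl.false
    · exact hr.false
  obtain ⟨c, hc, huc⟩ := exists_isChild_of_isDescendant
    ((mem_subtree_iff.1 (mem_subtree_of_owns hu hl.le hr.le)).resolve_left hne)
  have hlr := left_lt_right u
  obtain ⟨hl', hr'⟩ := huc
  exact ⟨c, hc, by rcases hu with rfl | rfl <;> omega⟩

lemma first_or_last_of_isChild (hσ : σ.IsBinary) {c v : σ.Node} (h : c.IsChild v) :
    left v + 1 = left c ∨ right c + 1 = right v := by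
  by_contra! hne
  obtain ⟨hl, hr⟩ := isDescendant_iff.1 h.1
  have hc := left_lt_right c
  obtain ⟨a, ha, hla, _⟩ := exists_isChild_of_lt_of_lt (v := v) (k := left v + 1)
    (by omega) (by omega)
  obtain ⟨b, hb, _, hrb⟩ := exists_isChild_of_lt_of_lt (v := v) (k := right v - 1)
    (by omega) (by omega)
  have hac : a ≠ c := by
    rintro rfl
    have := ha.1.1
    omega
  have hbc : b ≠ c := by
    rintro rfl
    have := hb.1.2
    omega
  have hab : a ≠ b := by
    rintro rfl
    have := right_lt_left_or_of_isChild ha h hac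
    omega
  have hthree : 2 < {u : σ.Node | u.IsChild v}.ncard :=
    (Set.two_lt_ncard_iff (Set.toFinite _)).2 ⟨a, b, c, ha, hb, h, hab, hac, hbc⟩
  exact hthree.not_ge (hσ v)

lemma exists_subtree_eq_univ (h : σ.IsNested) : ∃ v : σ.Node, subtree v = Set.univ := by
  have hne := DyckWord.toList_ne_nil.2 h.1
  obtain ⟨v, hv⟩ := exists_left_eq (σ := σ) (i := ⟨0, List.length_pos_iff.2 hne⟩) <| by
    rw [List.get_mk_zero]
    exact σ.head_eq_U hne
  have hl : left v = 0 := congrArg Fin.val hv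
  have hr : σ.toList.length ≤ right v + 1 := by
    by_contra! hlt
    have hpos := h.2 (i := right v + 1) (Nat.succ_pos _) hlt
    have hzero := height_right_add_one v
    rw [hl, height_zero, height, excess] at hzero
    omega
  refine ⟨v, Set.eq_univ_of_forall fun u => mem_subtree_of_owns (.inl rfl) (by omega) ?_⟩
  have := u.1.1.2
  dsimp only [left] at *
  omega

lemma treeGraph_adj {u v : σ.Node} : σ.treeGraph.Adj u v ↔ u.IsChild v ∨ v.IsChild u := by
  rw [DyckWord.treeGraph, SimpleGraph.fromRel_adj, and_iff_right_iff_imp]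
  rintro (h | h) rfl <;> exact h.1.1.false

/-! ### Simple re-pairings as enumerations of the nodes -/

/-- The positions occupied by the pairs in `S`. -/
def positions (S : Set σ.Node) : Set ℤ :=
  {b | ∃ u ∈ S, b = left u ∨ b = right u}

lemma mem_positions {S : Set σ.Node} {u : σ.Node} {k : ℕ} (hu : Owns u k) :
    (k : ℤ) ∈ positions S ↔ u ∈ S := by
  constructor
  · rintro ⟨v, hv, hk⟩
    have hvk : Owns v k := by
      rw [Owns]
      omega
    rwa [hu.eq hvk]
  · exact fun h => ⟨u, h, hu.imp (fun h => by rw [h]) (fun h => by rw [h])⟩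

lemma positions_eq_union (S : Set σ.Node) :
    positions S = (fun u => (left u : ℤ)) '' S ∪ (fun u => (right u : ℤ)) '' S := by
  ext b
  simp only [positions, Set.mem_ofPred_eq, Set.mem_union, Set.mem_image, and_or_left, exists_or,
    eq_comm]

lemma finite_positions (S : Set σ.Node) : (positions S).Finite := by
  rw [positions_eq_union]
  exact (S.toFinite.image _).union (S.toFinite.image _)

@[simp]
lemma positions_empty : positions (∅ : Set σ.Node) = ∅ := by
  rw [positions_eq_union, Set.image_empty, Set.image_empty, Set.union_empty]

lemma positions_union (S T : Set σ.Node) :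
    positions (S ∪ T) = positions S ∪ positions T := by
  simp only [positions_eq_union, Set.image_union]
  exact Set.union_union_union_comm _ _ _ _

lemma positions_subtree (v : σ.Node) :
    positions (subtree v) = Set.Icc (left v : ℤ) (right v) := by
  ext b
  rw [Set.mem_Icc]
  constructor
  · rintro ⟨u, ⟨hl, hr⟩, hb⟩
    have := left_lt_right u
    omega
  · rintro ⟨hl, hr⟩
    lift b to ℕ using by omega
    rw [Nat.cast_le] at hl hr
    obtain ⟨u, hu⟩ := exists_owns (hr.trans_lt v.1.2.2)
    exact (mem_positions hu).2 (mem_subtree_of_owns hu hl hr)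

/-- The simple re-pairing which erases the matched pairs of `σ` in the order given by `e`. -/
def repairingOfEquiv (e : Fin σ.semilength ≃ σ.Node) : σ.Repairing where
  pair t := (e t).1
  left_plus t := get_left (e t)
  right_minus t := get_right (e t)
  left_lt_right t := left_lt_right (e t)
  existsUnique k := by
    obtain ⟨u, hu⟩ := exists_owns k.2
    refine ⟨e.symm u, ?_, fun t ht => e.eq_symm_apply.2 (Owns.eq (k := k) ?_ hu)⟩
    · simp only [e.apply_symm_apply]
      exact hu.imp Fin.ext Fin.ext
    · exact ht.imp (congrArg Fin.val) (congrArg Fin.val)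

lemma isSimple_repairingOfEquiv (e : Fin σ.semilength ≃ σ.Node) :
    (repairingOfEquiv e).IsSimple :=
  fun t => (e t).2

lemma exists_eq_repairingOfEquiv {p : σ.Repairing} (hp : p.IsSimple) :
    ∃ e, p = repairingOfEquiv e := by
  have hinj : Function.Injective fun t => (⟨p.pair t, hp t⟩ : σ.Node) := fun s t hst =>
    (p.existsUnique (p.pair t).1).unique (.inl (congrArg (·.1.1) hst)) (.inl rfl)
  have hcard : Nat.card σ.Node ≤ Nat.card (Fin σ.semilength) := by
    rw [card_node, Nat.card_fin]
  exact ⟨.ofBijective _ (hinj.bijective_of_nat_card_le hcard), rfl⟩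

lemma erased_repairingOfEquiv (e : Fin σ.semilength ≃ σ.Node) (t : ℕ) :
    (repairingOfEquiv e).erased t = positions {u | (e.symm u : ℕ) < t} := by
  ext b
  refine e.exists_congr fun i => ?_
  rw [Set.mem_ofPred_eq, e.symm_apply_apply]
  rfl

lemma intervalWidth_erased_le_width (p : σ.Repairing) {t : ℕ} (ht : t ≤ σ.semilength) :
    intervalWidth (p.erased t) ≤ p.width :=
  Finset.le_sup (f := fun t => intervalWidth (p.erased t))
    (Finset.mem_range.2 (Nat.lt_succ_of_le ht))

lemma isUnionOfIntervals_positions {p : σ.Repairing} {e : Fin σ.semilength ≃ σ.Node}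
    (hp : p = repairingOfEquiv e) (v : σ.Node) :
    IsUnionOfIntervals p.width (positions (e.symm ⁻¹' Set.Iic (e.symm v))) := by
  have h : positions (e.symm ⁻¹' Set.Iic (e.symm v)) = p.erased (e.symm v + 1) := by
    subst hp
    simp only [erased_repairingOfEquiv, Nat.lt_succ_iff]
    rfl
  refine (IsUnionOfIntervals.intervalWidth_of_finite (finite_positions _)).mono ?_
  rw [h]
  exact intervalWidth_erased_le_width p (e.symm v).2

lemma one_le_width {p : σ.Repairing} (hp : p.IsSimple) (v : σ.Node) : 1 ≤ p.width := by
  obtain ⟨e, he⟩ := exists_eq_repairingOfEquiv hp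
  by_contra! hzero
  have hempty := isUnionOfIntervals_positions he v
  rw [Nat.lt_one_iff.1 hzero] at hempty
  exact Set.eq_empty_iff_forall_notMem.1 hempty.eq_empty _
    ((mem_positions (.inl rfl)).2 (Set.mem_preimage.2 Set.self_mem_Iic))

/-! ### The width is at least linear in the height -/

lemma exists_owns_owns_of_adj (hσ : σ.IsBinary) {x y : σ.Node} (h : σ.treeGraph.Adj x y) :
    ∃ i, Owns x i ∧ Owns y (i + 1) ∨ Owns y i ∧ Owns x (i + 1) := by
  simp only [Owns]
  rcases treeGraph_adj.1 h with h | h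
  · rcases first_or_last_of_isChild hσ h with h' | h'
    · exact ⟨left y, by omega⟩
    · exact ⟨right x, by omega⟩
  · rcases first_or_last_of_isChild hσ h with h' | h'
    · exact ⟨left x, by omega⟩
    · exact ⟨right y, by omega⟩

lemma encard_edgesBetween_compl_le (hσ : σ.IsBinary) {m : ℕ} {A : Set σ.Node}
    (hA : IsUnionOfIntervals m (positions A)) :
    (edgesBetween σ.treeGraph A Aᶜ).encard ≤ 2 * m := by
  choose! g hg using fun (e : σ.Node × σ.Node) (he : e ∈ edgesBetween σ.treeGraph A Aᶜ) =>
    exists_owns_owns_of_adj hσ he.2.2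
  refine (Set.encard_le_encard_of_injOn (f := fun e => (g e : ℤ)) ?_ ?_).trans
    hA.encard_switches_le
  · rintro e he
    rw [switches, Set.mem_ofPred_eq, ← Nat.cast_succ]
    rcases hg e he with ⟨h₁, h₂⟩ | ⟨h₂, h₁⟩ <;> rw [mem_positions h₁, mem_positions h₂]
    · exact fun h => he.2.1 (h.1 he.1)
    · exact fun h => he.2.1 (h.2 he.1)
  · intro e he e' he' hee
    have hg' := hg e' he'
    rw [← Nat.cast_injective hee] at hg'
    rcases hg e he with ⟨h₁, h₂⟩ | ⟨h₂, h₁⟩ <;> rcases hg' with ⟨h₁', h₂'⟩ | ⟨h₂', h₁'⟩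
    · exact Prod.ext (h₁.eq h₁') (h₂.eq h₂')
    · exact (he'.2.1 (h₁.eq h₂' ▸ he.1)).elim
    · exact (he.2.1 (h₂.eq h₁' ▸ he'.1)).elim
    · exact Prod.ext (h₁.eq h₁') (h₂.eq h₂')

theorem height_le_width (hσ : σ.IsBinary) {p : σ.Repairing} (hp : p.IsSimple) {h : ℕ}
    (hh : (completeBinaryTree h).IsMinorOf σ.treeGraph) : h ≤ 4 * p.width + 1 := by
  obtain ⟨e, he⟩ := exists_eq_repairingOfEquiv hp
  obtain ⟨B, hB⟩ := completeBinaryTree_isMinorOf_iff.1 hh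
  have hbranching : Branching σ.treeGraph (h / 2) (below B []) :=
    hB.branching_below (by rw [List.length_nil]; omega)
  obtain ⟨v, -, hv⟩ := hbranching.exists_le_encard_edgesBetween e.symm.injective
  have hcut : (h / 2 : ℕ) ≤ ((2 * p.width : ℕ) : ℕ∞) := by
    refine (hv.trans (Set.encard_le_encard ?_)).trans
      (encard_edgesBetween_compl_le hσ (isUnionOfIntervals_positions he v))
    exact edgesBetween_mono Set.inter_subset_right fun _ hx => hx.2
  have := Nat.cast_le.1 hcut
  omega

/-! ### The width is at most linear in the height -/

/-- The list `L` enumerates `S` without repetition, and each of its initial segments occupies at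
most `k` intervals of positions. -/
structure IsEnumeration (k : ℕ) (S : Set σ.Node) (L : List σ.Node) : Prop where
  nodup : L.Nodup
  mem_iff : ∀ u, u ∈ L ↔ u ∈ S
  isUnionOfIntervals : ∀ P, P <+: L → IsUnionOfIntervals k (positions {u | u ∈ P})

namespace IsEnumeration

variable {k l : ℕ} {S T : Set σ.Node} {L M : List σ.Node}

lemma setOf_mem (h : IsEnumeration k S L) : {u | u ∈ L} = S := Set.ext h.mem_iff

lemma nil (k : ℕ) : IsEnumeration k (∅ : Set σ.Node) [] := by
  refine ⟨List.nodup_nil, fun u => by simp, fun P hP => ?_⟩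
  rw [List.prefix_nil.1 hP]
  simpa using IsUnionOfIntervals.empty k

lemma append (hL : IsEnumeration k S L) (hM : IsEnumeration l T M) (hST : Disjoint S T)
    (hS : IsUnionOfIntervals 1 (positions S)) : IsEnumeration (max k (l + 1)) (S ∪ T) (L ++ M) := by
  refine ⟨List.nodup_append'.2 ⟨hL.nodup, hM.nodup, fun u huL huM => ?_⟩, fun u => ?_,
    fun P hP => ?_⟩
  · exact Set.disjoint_left.1 hST ((hL.mem_iff u).1 huL) ((hM.mem_iff u).1 huM)
  · rw [List.mem_append, hL.mem_iff, hM.mem_iff, Set.mem_union]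
  · rcases List.prefix_or_prefix_of_prefix hP (List.prefix_append L M) with hPL | ⟨Q, rfl⟩
    · exact (hL.isUnionOfIntervals P hPL).mono (le_max_left _ _)
    · have hQ := hM.isUnionOfIntervals Q ((List.prefix_append_right_inj L).1 hP)
      have hunion : {u | u ∈ L ++ Q} = {u | u ∈ Q} ∪ S := by
        rw [← hL.setOf_mem]
        ext u
        simp [or_comm]
      rw [hunion, positions_union]
      exact (hQ.union hS).mono (le_max_right _ _)

lemma concat (hL : IsEnumeration k S L) {v : σ.Node} (hv : v ∉ S)
    (hS : IsUnionOfIntervals k (positions (insert v S))) :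
    IsEnumeration k (insert v S) (L ++ [v]) := by
  have hmem : ∀ u, u ∈ L ++ [v] ↔ u ∈ insert v S := fun u => by
    rw [List.mem_append, hL.mem_iff, List.mem_singleton, Set.mem_insert_iff, or_comm]
  refine ⟨?_, hmem, fun P hP => ?_⟩
  · rw [← List.concat_eq_append]
    exact hL.nodup.concat fun h => hv ((hL.mem_iff v).1 h)
  rcases List.prefix_concat_iff.1 hP with rfl | hPL
  · rwa [show {u | u ∈ L ++ [v]} = insert v S from Set.ext hmem]
  · exact hL.isUnionOfIntervals P hPL

lemma concat_root {v : σ.Node}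
    (hL : IsEnumeration (k + 1) (⋃ c ∈ {c : σ.Node | c.IsChild v}, subtree c) L) :
    IsEnumeration (k + 1) (subtree v) (L ++ [v]) := by
  have hv : IsUnionOfIntervals (k + 1) (positions (subtree v)) := by
    rw [positions_subtree]
    exact (IsUnionOfIntervals.icc _ _).mono (Nat.le_add_left 1 k)
  rw [subtree_eq_insert] at hv ⊢
  refine hL.concat (fun h => ?_) hv
  obtain ⟨c, hc, hvc⟩ := Set.mem_iUnion₂.1 h
  exact notMem_subtree_of_isChild hc hvc

lemma exists_isSimple (hL : IsEnumeration k (Set.univ : Set σ.Node) L) :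
    ∃ p : σ.Repairing, p.IsSimple ∧ p.width ≤ k := by
  classical
  let e := hL.nodup.getEquivOfForallMemList L fun u => (hL.mem_iff u).2 (Set.mem_univ u)
  have hlength : σ.semilength = L.length := by
    rw [← card_node, ← Nat.card_congr e, Nat.card_fin]
  refine ⟨repairingOfEquiv ((finCongr hlength).trans e), isSimple_repairingOfEquiv _,
    Finset.sup_le fun t _ => ?_⟩
  rw [erased_repairingOfEquiv]
  have htake : {u | ((((finCongr hlength).trans e).symm u : Fin σ.semilength) : ℕ) < t} =
      {u | u ∈ L.take t} :=
    Set.ext fun u => (List.mem_take_iff_idxOf_lt ((hL.mem_iff u).2 (Set.mem_univ u))).symm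
  rw [htake]
  exact (hL.isUnionOfIntervals _ (List.take_prefix t L)).intervalWidth_le

end IsEnumeration

lemma hasRootedBinaryMinor_of_isChild {k : ℕ} {c v : σ.Node} (h : c.IsChild v)
    (hc : HasRootedBinaryMinor σ.treeGraph k (subtree c) c) :
    HasRootedBinaryMinor σ.treeGraph k (subtree v) v := by
  rw [subtree_eq_insert v]
  exact (hc.extend (treeGraph_adj.2 (.inr h)) (notMem_subtree_of_isChild h)).mono
    (Set.insert_subset_insert (Set.subset_biUnion_of_mem h))

lemma hasRootedBinaryMinor_succ {k : ℕ} {c : Bool → σ.Node} {v : σ.Node} (hinj : c.Injective)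
    (h : ∀ b, (c b).IsChild v)
    (hc : ∀ b, HasRootedBinaryMinor σ.treeGraph k (subtree (c b)) (c b)) :
    HasRootedBinaryMinor σ.treeGraph (k + 1) (subtree v) v := by
  rw [subtree_eq_insert v]
  refine (HasRootedBinaryMinor.join hc (fun b b' hb => disjoint_subtree (h b) (h b') (hinj.ne hb))
    (fun b => treeGraph_adj.2 (.inr (h b))) fun b => notMem_subtree_of_isChild (h b)).mono ?_
  exact Set.insert_subset_insert
    (Set.iUnion_subset fun b => Set.subset_biUnion_of_mem (u := subtree) (h b))

/-- The number `k` controls the subtree of `v` from both sides: its nodes can be enumerated using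
`k + 1` intervals, and it has a complete binary tree of height `k` as a minor. The recursion below
computes such a `k` as the Horton–Strahler number of `v`. -/
structure IsStrahler (k : ℕ) (v : σ.Node) : Prop where
  exists_isEnumeration : ∃ L, IsEnumeration (k + 1) (subtree v) L
  hasRootedBinaryMinor : HasRootedBinaryMinor σ.treeGraph k (subtree v) v

namespace IsStrahler

variable {k l : ℕ} {a b v : σ.Node}

lemma zero (hv : {c : σ.Node | c.IsChild v} = ∅) : IsStrahler 0 v where
  exists_isEnumeration := by
    have hnil : IsEnumeration 1 (⋃ c ∈ {c : σ.Node | c.IsChild v}, subtree c) [] := by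
      rw [hv, Set.biUnion_empty]
      exact .nil 1
    exact ⟨_, hnil.concat_root⟩
  hasRootedBinaryMinor := by
    rw [subtree_eq_insert v, hv, Set.biUnion_empty, insert_empty_eq]
    exact .zero _ v

lemma of_singleton (ha : IsStrahler k a) (hv : {c : σ.Node | c.IsChild v} = {a}) :
    IsStrahler k v where
  exists_isEnumeration := by
    obtain ⟨L, hL⟩ := ha.exists_isEnumeration
    rw [← Set.biUnion_singleton a subtree, ← hv] at hL
    exact ⟨_, hL.concat_root⟩
  hasRootedBinaryMinor :=
    hasRootedBinaryMinor_of_isChild (hv.ge (Set.mem_singleton a)) ha.hasRootedBinaryMinor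

lemma exists_isEnumeration_of_pair (ha : IsStrahler k a) (hb : IsStrahler l b) (hab : a ≠ b)
    (hv : {c : σ.Node | c.IsChild v} = {a, b}) :
    ∃ L, IsEnumeration (max k (l + 1) + 1) (subtree v) L := by
  obtain ⟨L, hL⟩ := ha.exists_isEnumeration
  obtain ⟨M, hM⟩ := hb.exists_isEnumeration
  have hLM := hL.append hM
    (disjoint_subtree (v := v) (hv.ge (Set.mem_insert a _)) (hv.ge (.inr rfl)) hab)
    (by rw [positions_subtree]; exact .icc _ _)
  rw [← Set.biUnion_pair, ← hv, max_add_add_right] at hLM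
  exact ⟨_, hLM.concat_root⟩

lemma of_lt (ha : IsStrahler k a) (hb : IsStrahler l b) (hab : a ≠ b) (hlk : l < k)
    (hv : {c : σ.Node | c.IsChild v} = {a, b}) : IsStrahler k v where
  exists_isEnumeration := by
    simpa only [max_eq_left (Nat.succ_le_of_lt hlk)] using
      ha.exists_isEnumeration_of_pair hb hab hv
  hasRootedBinaryMinor :=
    hasRootedBinaryMinor_of_isChild (hv.ge (Set.mem_insert a _)) ha.hasRootedBinaryMinor

lemma succ (ha : IsStrahler k a) (hb : IsStrahler k b) (hab : a ≠ b)
    (hv : {c : σ.Node | c.IsChild v} = {a, b}) : IsStrahler (k + 1) v where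
  exists_isEnumeration := by
    simpa only [max_eq_right (Nat.le_succ k)] using ha.exists_isEnumeration_of_pair hb hab hv
  hasRootedBinaryMinor := by
    refine hasRootedBinaryMinor_succ (c := fun t => cond t a b) ?_ ?_ ?_
    · exact Bool.injective_iff.2 hab.symm
    · exact Bool.forall_bool.2 ⟨hv.ge (.inr rfl), hv.ge (.inl rfl)⟩
    · exact Bool.forall_bool.2 ⟨hb.hasRootedBinaryMinor, ha.hasRootedBinaryMinor⟩

end IsStrahler

theorem exists_isStrahler (hσ : σ.IsBinary) (v : σ.Node) : ∃ k, IsStrahler k v := by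
  induction hn : right v - left v using Nat.strong_induction_on generalizing v with
  | _ n ih =>
  have ihchild : ∀ c ∈ {c : σ.Node | c.IsChild v}, ∃ k, IsStrahler k c := fun c hc => by
    obtain ⟨hl, hr⟩ := isDescendant_iff.1 hc.1
    have := left_lt_right c
    exact ih _ (by omega) c rfl
  have hcard := hσ v
  interval_cases hchildren : {c : σ.Node | c.IsChild v}.ncard
  · exact ⟨0, .zero ((Set.ncard_eq_zero (Set.toFinite _)).1 hchildren)⟩
  · obtain ⟨a, ha⟩ := Set.ncard_eq_one.1 hchildren
    obtain ⟨k, hk⟩ := ihchild a (ha.ge (Set.mem_singleton a))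
    exact ⟨k, hk.of_singleton ha⟩
  · obtain ⟨a, b, hab, hpair⟩ := Set.ncard_eq_two.1 hchildren
    obtain ⟨k, hk⟩ := ihchild a (hpair.ge (.inl rfl))
    obtain ⟨l, hl⟩ := ihchild b (hpair.ge (.inr rfl))
    rcases lt_trichotomy k l with hkl | rfl | hlk
    · exact ⟨l, hl.of_lt hk hab.symm hkl (hpair.trans (Set.pair_comm a b))⟩
    · exact ⟨k + 1, hk.succ hl hab hpair⟩
    · exact ⟨k, hk.of_lt hl hab hlk hpair⟩

lemma isMinorOf_one_of_isChild_of_isChild {u v w : σ.Node} (huv : u.IsChild v)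
    (hvw : v.IsChild w) : (completeBinaryTree 1).IsMinorOf σ.treeGraph := by
  have huw : u ≠ w := by
    rintro rfl
    exact (huv.1.1.trans hvw.1.1).false
  exact (HasRootedBinaryMinor.one huw (treeGraph_adj.2 (.inr huv))
    (treeGraph_adj.2 (.inl hvw))).isMinorOf

lemma isMinorOf_one (hσ : σ.IsNested) (hcard : 3 ≤ σ.semilength) :
    (completeBinaryTree 1).IsMinorOf σ.treeGraph := by
  obtain ⟨r, hr⟩ := exists_subtree_eq_univ hσ
  have hparent : ∀ u, u ≠ r → ∃ p : σ.Node, u.IsChild p := fun u hu =>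
    exists_isChild_parent ((mem_subtree_iff.1 (hr.ge (Set.mem_univ u))).resolve_left hu)
  have htwo : 1 < ((Set.univ : Set σ.Node) \ {r}).ncard := by
    rw [Set.ncard_sdiff_singleton_of_mem (Set.mem_univ r), Set.ncard_univ, card_node]
    omega
  obtain ⟨x, y, hx, hy, hxy⟩ := (Set.one_lt_ncard_iff (Set.toFinite _)).1 htwo
  obtain ⟨p, hp⟩ := hparent x hx.2
  obtain ⟨q, hq⟩ := hparent y hy.2
  by_cases hpr : p = r
  · by_cases hqr : q = r
    · subst hpr hqr
      exact (HasRootedBinaryMinor.one hxy (treeGraph_adj.2 (.inr hp))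
        (treeGraph_adj.2 (.inr hq))).isMinorOf
    · obtain ⟨_, hq'⟩ := hparent q hqr
      exact isMinorOf_one_of_isChild_of_isChild hq hq'
  · obtain ⟨_, hp'⟩ := hparent p hpr
    exact isMinorOf_one_of_isChild_of_isChild hp hp'

end DyckTree

theorem mainTheorem8 :
    ∃ C : ℕ, ∀ σ : DyckWord, σ.IsNested → σ.IsBinary →
      ∃ w h : ℕ,
        IsLeast {k : ℕ | ∃ p : σ.Repairing, p.IsSimple ∧ p.width = k} w ∧
        IsGreatest {k : ℕ | (completeBinaryTree k).IsMinorOf σ.treeGraph} h ∧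
        h ≤ C * w ∧
        (3 ≤ σ.semilength → w ≤ C * h) := by
  refine ⟨5, fun σ hnested hbinary => ?_⟩
  obtain ⟨r, hr⟩ := DyckTree.exists_subtree_eq_univ hnested
  obtain ⟨k, ⟨L, hL⟩, hminor⟩ := DyckTree.exists_isStrahler hbinary r
  obtain ⟨p, hp, hpk⟩ := (hr ▸ hL).exists_isSimple
  obtain ⟨w, hw⟩ := BddBelow.exists_isLeast_of_nonempty (OrderBot.bddBelow _)
    (⟨_, p, hp, rfl⟩ : {k : ℕ | ∃ p : σ.Repairing, p.IsSimple ∧ p.width = k}.Nonempty)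
  obtain ⟨h, hh⟩ := BddAbove.exists_isGreatest_of_nonempty
    ⟨_, fun _ hm => DyckTree.height_le_width hbinary hp hm⟩ ⟨k, hminor.isMinorOf⟩
  refine ⟨w, h, hw, hh, ?_, fun hcard => ?_⟩
  · obtain ⟨q, hq, rfl⟩ := hw.1
    have hhw := DyckTree.height_le_width hbinary hq hh.1
    have hpos := DyckTree.one_le_width hq r
    omega
  · have hwp := hw.2 ⟨p, hp, rfl⟩
    have hkh := hh.2 hminor.isMinorOf
    have honeh := hh.2 (DyckTree.isMinorOf_one hnested hcard)
    omega
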